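/- Let $(\Omega,\mathscr F,\mathbf P)$ be a probability space and let $N=(N_t)_{t\ge 0}$ be a point process: a process with values in $\{0,1,2,\dots\}$, $N_0=0$, with nondecreasing right-continuous paths all of whose jumps have size one. Let $(\mathscr F_t)_{t\ge0}$ be its internal history, possibly enlarged by initial information, i.e. $\mathscr F_t=\mathscr F_0\vee\sigma(N_s:0\le s\le t)$ for all $t\ge 0$. Let $T_n=\inf\{t\ge 0:N_t\ge n\}\in[0,\infty]$ be the arrival times, $U_{n+1}=T_{n+1}-T_n\in(0,\infty]$ (on $\{T_n<\infty\}$) the waiting times, and $\mathscr F_{T_n}$ the σ-algebra of the stopping time $T_n$. Suppose that, for each $n\ge0$, $F_n(\omega,du)$ is a regular conditional distribution of $U_{n+1}$ given $\mathscr F_{T_n}$, on $\{T_n<\infty\}$: a probability kernel from $(\Omega,\mathscr F_{T_n})$ to $[0,\infty]$ such that for every Borel set $B$, almost surely on $\{T_n<\infty\}$, $F_n(\cdot,B)=\mathbf P(U_{n+1}\in B\mid\mathscr F_{T_n})$. Write $F_n(x-)=F_n([0,x))$ and define $$A_t=\sum_{n=0}^\infty A^{(n)}_t,\qquad A^{(n)}_t=\begin{cases}0,&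 t\le T_n,\\[2pt] \displaystyle\int_{(0,\,t-T_n]}\frac{F_n(dx)}{1-F_n(x-)},& T_n<t\le T_{n+1},\\[8pt] \displaystyle\int_{(0,\,T_{n+1}-T_n]}\frac{F_n(dx)}{1-F_n(x-)},& t>T_{n+1}\end{cases}$$ (the integrated hazard function). Then $A$ is a predictable increasing version of the mean intensity (compensator) of $N$. That is: 1. $A$ is predictable with values in $[0,\infty]$, $A_0=0$, its paths are nondecreasing and right-continuous, and almost surely $A_t<\infty$ for all $t$. 2. For $0\le s\le t$ and $C\in\mathscr F_s$, $\mathbf E[(N_t-N_s)\mathbf 1_C]=\mathbf E[(A_t-A_s)\mathbf 1_C]$ in $[0,\infty]$. 3. $N-A$ is a local martingale with respect to $(\mathscr F_t)$: the $T_n$ are stopping times that increase to $\infty$, and for each $n$ the process $(N_{t\wedge T_n}-A_{t\wedge T_n})_{t\ge0}$ is a martingale. 4. If $\mathbf E[N_t]<\infty$ for all $t$, or $\mathbf E[A_t]<\infty$ for all $t$, then $N-A$ is a martingale with respect to $(\mathscr F_t)$. -/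

import Mathlib

open MeasureTheory ProbabilityTheory Filter Topology Set
open scoped ENNReal NNReal

noncomputable section

namespace PointProcess

variable {Ω : Type*} {m : MeasurableSpace Ω}

/-- A (simple, non-explosive) point process, given by its counting process: it starts at `0`,
and its paths are finite, nondecreasing, right-continuous and have jumps of size one only. -/
structure IsPointProcess (N : ℝ≥0 → Ω → ℕ) : Prop where
  zero : ∀ ω, N 0 ω = 0
  mono : ∀ ω, Monotone fun t => N t ω
  rightCts : ∀ ω t, ContinuousWithinAt (fun u => N u ω) (Ici t) t
  unit_jumps : ∀ ω t, 0 < t → ∃ s < t, N t ω ≤ N s ω + 1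

/-- `𝓕` is the internal history of `N` together with initial information: for every `t`, `𝓕 t` is
generated by `𝓕 0` and the variables `N s`, `s ≤ t`. If `𝓕 0` is trivial, it is the filtration
generated by `N`. -/
def IsInternalHistory (𝓕 : Filtration ℝ≥0 m) (N : ℝ≥0 → Ω → ℕ) : Prop :=
  ∀ t, 𝓕 t = 𝓕 0 ⊔ ⨆ s ∈ Iic t, MeasurableSpace.comap (N s) ⊤

/-- The arrival times `T n = inf {t ≥ 0 : N t ≥ n}`, equal to `∞` if there is no such `t`. -/
def arrivalTime (N : ℝ≥0 → Ω → ℕ) (n : ℕ) (ω : Ω) : ℝ≥0∞ :=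
  ⨅ (t : ℝ≥0) (_ : n ≤ N t ω), (t : ℝ≥0∞)

/-- The waiting times `U (n + 1) = T (n + 1) - T n`; only their values on `{T n < ∞}` matter. -/
def waitingTime (N : ℝ≥0 → Ω → ℕ) (n : ℕ) (ω : Ω) : ℝ≥0∞ :=
  arrivalTime N (n + 1) ω - arrivalTime N n ω

lemma arrivalTime_le_iff {N : ℝ≥0 → Ω → ℕ} (hN : IsPointProcess N) (n : ℕ) (ω : Ω) (t : ℝ≥0) :
    arrivalTime N n ω ≤ t ↔ n ≤ N t ω := by
  refine ⟨fun h => ?_, fun h => iInf₂_le t h⟩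
  have hev : ∀ᶠ u in 𝓝[≥] t, N u ω = N t ω :=
    (hN.rightCts ω t).eventually (IsOpen.mem_nhds (isOpen_discrete {N t ω}) rfl)
  obtain ⟨v, hv, hv'⟩ := (mem_nhdsGE_iff_exists_Ico_subset' (lt_add_one t)).1 hev
  have hlt : arrivalTime N n ω < v := h.trans_lt (by exact_mod_cast hv)
  simp only [arrivalTime, iInf_lt_iff] at hlt
  obtain ⟨u, hu, huv⟩ := hlt
  have huv' : u < v := by exact_mod_cast huv
  rcases le_total t u with htu | hut
  · have h1 : N u ω = N t ω := hv' ⟨htu, huv'⟩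
    omega
  · exact hu.trans (hN.mono ω hut)

lemma isStoppingTime_arrivalTime {𝓕 : Filtration ℝ≥0 m} {N : ℝ≥0 → Ω → ℕ}
    (hN : IsPointProcess N) (h𝓕 : IsInternalHistory 𝓕 N) (n : ℕ) :
    IsStoppingTime 𝓕 (arrivalTime N n) := by
  intro t
  have h1 : {ω | (arrivalTime N n ω : ℝ≥0∞) ≤ t} = N t ⁻¹' Ici n := by
    ext ω
    exact arrivalTime_le_iff hN n ω t
  have h2 : MeasurableSpace.comap (N t) ⊤ ≤ 𝓕 t := by
    rw [h𝓕 t]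
    exact le_sup_of_le_right (le_iSup₂_of_le t (mem_Iic.2 le_rfl) le_rfl)
  have h3 : MeasurableSet[𝓕 t] {ω | (arrivalTime N n ω : ℝ≥0∞) ≤ t} := by
    rw [h1]
    exact h2 _ ⟨Ici n, trivial, rfl⟩
  exact h3

/-- `κ` is a regular conditional distribution of `U`, given the σ-algebra `𝓖`, on the event `S`:
a probability kernel from `(Ω, 𝓖)`, such that for every measurable set `B` the variable `κ ω B` is
a version, on `S`, of the conditional probability of `{U ∈ B}` given `𝓖`. -/
structure IsRegularCondDistrib (P : Measure Ω) (𝓖 : MeasurableSpace Ω) (U : Ω → ℝ≥0∞)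
    (S : Set Ω) (κ : Ω → Measure ℝ≥0∞) : Prop where
  isProbabilityMeasure : ∀ ω, IsProbabilityMeasure (κ ω)
  measurable : Measurable[𝓖] κ
  condProb : ∀ B, MeasurableSet B → ∀ᵐ ω ∂P, ω ∈ S → (κ ω).real B = (P⟦U ⁻¹' B | 𝓖⟧) ω

/-- The integrated hazard function `∫_{(0, x]} F(dy) / (1 - F(y-))` of a probability measure `F`
on `[0, ∞]`, where `F(y-) = F([0, y))`. -/
def integratedHazard (F : Measure ℝ≥0∞) (x : ℝ≥0∞) : ℝ≥0∞ :=
  ∫⁻ y in Ioc 0 x, (1 - F (Iio y))⁻¹ ∂F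

/-- The `n`-th term: `0` for `t ≤ T n`, the integrated hazard function of `F n` at `t - T n` for
`T n < t ≤ T (n + 1)`, and constant (with the value at `T (n + 1)`) from then on. -/
def compensatorTerm (N : ℝ≥0 → Ω → ℕ) (F : ℕ → Ω → Measure ℝ≥0∞) (n : ℕ) (t : ℝ≥0) (ω : Ω) :
    ℝ≥0∞ :=
  open Classical in
  if (t : ℝ≥0∞) ≤ arrivalTime N n ω then 0
  else if (t : ℝ≥0∞) ≤ arrivalTime N (n + 1) ω then
    integratedHazard (F n ω) (t - arrivalTime N n ω)
  else integratedHazard (F n ω) (arrivalTime N (n + 1) ω - arrivalTime N n ω)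

/-- The process `A t = ∑ n, A⁽ⁿ⁾ t`. -/
def compensator (N : ℝ≥0 → Ω → ℕ) (F : ℕ → Ω → Measure ℝ≥0∞) (t : ℝ≥0) (ω : Ω) : ℝ≥0∞ :=
  ∑' n, compensatorTerm N F n t ω

/-- A predictable increasing process: predictable, null at `0`, with nondecreasing
right-continuous paths, and almost surely finite at all times. -/
structure IsPredictableIncreasing (𝓕 : Filtration ℝ≥0 m) (P : Measure Ω)
    (A : ℝ≥0 → Ω → ℝ≥0∞) : Prop where
  predictable : IsStronglyPredictable 𝓕 A
  zero : ∀ ω, A 0 ω = 0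
  mono : ∀ ω, Monotone fun t => A t ω
  rightCts : ∀ ω t, ContinuousWithinAt (fun u => A u ω) (Ici t) t
  finite : ∀ᵐ ω ∂P, ∀ t, A t ω < ∞

/-- The real-valued difference process `N t - A t`. -/
def compensated (N : ℝ≥0 → Ω → ℕ) (A : ℝ≥0 → Ω → ℝ≥0∞) (t : ℝ≥0) (ω : Ω) : ℝ :=
  (N t ω : ℝ) - (A t ω).toReal

/-- `A` is a predictable increasing mean intensity of `N`: it is a predictable increasing process,
the increments of `N` and `A` have the same conditional expectations (in `[0, ∞]`, so that no
integrability is needed), `N - A` is a local martingale, reduced by the arrival times, and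
it is a martingale as soon as `N t` or `A t` has finite expectation for every `t`. -/
structure IsMeanIntensity (𝓕 : Filtration ℝ≥0 m) (P : Measure Ω) (N : ℝ≥0 → Ω → ℕ)
    (A : ℝ≥0 → Ω → ℝ≥0∞) : Prop where
  predictableIncreasing : IsPredictableIncreasing 𝓕 P A
  increments : ∀ s t, s ≤ t → ∀ C, MeasurableSet[𝓕 s] C →
    ∫⁻ ω in C, ((N t ω : ℝ≥0∞) - N s ω) ∂P = ∫⁻ ω in C, (A t ω - A s ω) ∂P
  localizing : IsLocalizingSequence 𝓕 (arrivalTime N) P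
  stopped_martingale : ∀ n,
    Martingale (stoppedProcess (compensated N A) (arrivalTime N n)) 𝓕 P
  martingale : ((∀ t, ∫⁻ ω, (N t ω : ℝ≥0∞) ∂P < ∞) ∨ (∀ t, ∫⁻ ω, A t ω ∂P < ∞)) →
    Martingale (compensated N A) 𝓕 P

end PointProcess

end

/-! Everything rests on one identity for a single waiting time. If `U` has law `F` on `[0, ∞]`, then
by Tonelli the mean of `∫_{(a, b] ∩ [0, U]} F(dy) / (1 - F(y-))` is `∫_{(a, b]} F[y, ∞] / (1 -
F(y-)) F(dy) = F(a, b]`, because the quotient is `1` off the `F`-null set `{F(y-) = 1}`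
(`lintegral_lintegral_hazardRate`).

This is applied conditionally on the past of `T n`, with `a = s - T n`, `b = t - T n`. An event `C`
of the history at `s` need not belong to that past, but for an internal history it agrees on `{s < T
(n + 1)}` with an event that does (`exists_inter_lt_arrivalTime_eq`), and off `{s < T (n + 1)}` the
`n`-th term no longer grows after `s`. Hence the increment of the `n`-th term over `(s, t]` has
integral `P(C ∩ {N s ≤ n < N t})` on `C` (`setLIntegral_compensatorTerm_sub`). Summing over all `n`
gives the increments of `N`; summing over `n < k` gives those of the process stopped at `T k`.

Each term has mean at most `1`, which yields almost sure finiteness and integrability of the stopped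
processes. Predictability holds because after `T n` the `n`-th term depends only on time and the
past of `T n`, until it freezes at `T (n + 1)`. -/

noncomputable section

namespace PointProcess

/-! ### Integrated hazard of one distribution. -/

section Hazard

variable (F : Measure ℝ≥0∞)

lemma measurable_hazardRate : Measurable fun y => (1 - F (Iio y))⁻¹ := by
  have h : Monotone fun y => F (Iio y) := fun _ _ h => measure_mono (Iio_subset_Iio h)
  exact (measurable_const.sub h.measurable).inv

@[simp]
lemma integratedHazard_zero : integratedHazard F 0 = 0 := by
  simp [integratedHazard]

lemma integratedHazard_mono : Monotone (integratedHazard F) := fun _ _ h =>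
  lintegral_mono_set (Ioc_subset_Ioc_right h)

/-- The set is an up-set, and each of its points `y` satisfies `F [y, ∞] = 0`. It is covered by
`[inf, ∞]` if the infimum is attained, otherwise by countably many null rays `[u n, ∞]`. -/
lemma measure_setOf_measure_Iio_eq_one [IsProbabilityMeasure F] :
    F {y | F (Iio y) = 1} = 0 := by
  have h0 : ∀ y, F (Iio y) = 1 → F (Ici y) = 0 := fun y hy => by
    rw [← compl_Iio, prob_compl_eq_zero_iff measurableSet_Iio, hy]
  set S := {y | F (Iio y) = 1} with hS
  rcases S.eq_empty_or_nonempty with h | hne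
  · simp [h]
  by_cases hc : sInf S ∈ S
  · exact measure_mono_null (fun y hy => mem_Ici.2 (sInf_le hy)) (h0 _ hc)
  obtain ⟨u, -, hu, huS⟩ := exists_seq_tendsto_sInf hne (OrderBot.bddBelow S)
  refine measure_mono_null (t := ⋃ n, Ici (u n)) (fun y hy => ?_)
    (measure_iUnion_null fun n => h0 _ (huS n))
  have hlt : sInf S < y := lt_of_le_of_ne (sInf_le hy) fun h => hc (h ▸ hy)
  obtain ⟨n, hn⟩ := (hu.eventually (gt_mem_nhds hlt)).exists
  exact mem_iUnion.2 ⟨n, hn.le⟩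

lemma continuousWithinAt_integratedHazard [IsProbabilityMeasure F] (x : ℝ≥0∞) :
    ContinuousWithinAt (integratedHazard F) (Ici x) x := by
  rw [← Ioi_insert, continuousWithinAt_insert_self]
  set ν := F.withDensity fun y => (1 - F (Iio y))⁻¹ with hν
  have hH : ∀ z, integratedHazard F z = ν (Ioc 0 z) := fun z => by
    rw [hν, withDensity_apply _ measurableSet_Ioc, integratedHazard]
  -- On `(0, r]` the rate is at most `1 / (1 - F(r-))`, which is finite.
  have hlt : ∀ r, F (Iio r) ≠ 1 → ν (Ioc 0 r) ≠ ∞ := fun r hr => by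
    have h1 : F (Iio r) < 1 := lt_of_le_of_ne prob_le_one hr
    rw [← hH]
    refine ne_top_of_le_ne_top (b := (1 - F (Iio r))⁻¹ * F (Ioc 0 r)) ?_ ?_
    · refine ENNReal.mul_ne_top (ENNReal.inv_ne_top.2 (tsub_pos_of_lt h1).ne')
        (measure_ne_top _ _)
    · rw [← setLIntegral_const]
      refine setLIntegral_mono measurable_const fun y hy => ?_
      exact ENNReal.inv_le_inv.2 (tsub_le_tsub_left (measure_mono (Iio_subset_Iio hy.2)) _)
  -- Either the hazard is finite slightly beyond `x` and continuity from above applies, or `F(r-) =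
  -- 1` for all `r > x`; then `(x, ∞]` is null and the hazard, possibly infinite, is constant from
  -- `x` on.
  by_cases hx : ∃ r > x, F (Iio r) ≠ 1
  · obtain ⟨r, hr, hr1⟩ := hx
    have := tendsto_measure_biInter_gt (μ := ν) (s := fun r => Ioc 0 r) (a := x)
      (fun _ _ => measurableSet_Ioc.nullMeasurableSet)
      (fun i j _ hij => Ioc_subset_Ioc_right hij) ⟨r, hr, hlt r hr1⟩
    have hI : ⋂ r > x, Ioc 0 r = Ioc 0 x := by
      ext y
      simp only [mem_iInter, mem_Ioc]
      refine ⟨fun h => ⟨(h r hr).1, le_of_forall_gt_imp_ge_of_dense fun z hz => (h z hz).2⟩,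
        fun h z hz => ⟨h.1, h.2.trans (le_of_lt hz)⟩⟩
    rw [hI] at this
    unfold ContinuousWithinAt
    rw [hH]
    exact this.congr fun z => (hH z).symm
  · push Not at hx
    have h0 : ν (Ioi x) = 0 := withDensity_absolutelyContinuous _ _
      (measure_mono_null (fun y hy => hx y hy) (measure_setOf_measure_Iio_eq_one F))
    refine tendsto_const_nhds.congr' ?_
    filter_upwards [self_mem_nhdsWithin] with y hy
    refine le_antisymm (integratedHazard_mono F (le_of_lt hy)) ?_
    rw [hH, hH]
    calc ν (Ioc 0 y) ≤ ν (Ioc 0 x ∪ Ioi x) := measure_mono fun z hz => by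
          rcases le_or_gt z x with h | h
          · exact Or.inl ⟨hz.1, h⟩
          · exact Or.inr h
      _ ≤ ν (Ioc 0 x) + ν (Ioi x) := measure_union_le _ _
      _ = ν (Ioc 0 x) := by rw [h0, add_zero]

/-- The mass that the integrated hazard function puts on `(a, b]`, stopped at an independent
variable with distribution `F`, has mean `F (a, b]`. -/
lemma lintegral_lintegral_hazardRate [IsProbabilityMeasure F] (a b : ℝ≥0∞) :
    ∫⁻ u, ∫⁻ y in Ioc a b ∩ Iic u, (1 - F (Iio y))⁻¹ ∂F ∂F = F (Ioc a b) := by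
  have hm := measurable_hazardRate F
  have h1 : ∀ u, ∫⁻ y in Ioc a b ∩ Iic u, (1 - F (Iio y))⁻¹ ∂F
      = ∫⁻ y in Ioc a b, (Iic u).indicator (fun y => (1 - F (Iio y))⁻¹) y ∂F := fun u => by
    rw [lintegral_indicator measurableSet_Iic, Measure.restrict_restrict measurableSet_Iic,
      inter_comm]
  have hmeas : Measurable fun p : ℝ≥0∞ × ℝ≥0∞ =>
      (Iic p.1).indicator (fun y => (1 - F (Iio y))⁻¹) p.2 := by
    have : (fun p : ℝ≥0∞ × ℝ≥0∞ => (Iic p.1).indicator (fun y => (1 - F (Iio y))⁻¹) p.2)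
        = {p : ℝ≥0∞ × ℝ≥0∞ | p.2 ≤ p.1}.indicator fun p => (1 - F (Iio p.2))⁻¹ := by
      ext p; simp [indicator]
    rw [this]
    exact (hm.comp measurable_snd).indicator (measurableSet_le measurable_snd measurable_fst)
  simp_rw [h1]
  -- After the swap the inner integral is `F [y, ∞] / (1 - F(y-))`, equal to `1` for almost every
  -- `y`.
  rw [lintegral_lintegral_swap hmeas.aemeasurable, ← setLIntegral_one]
  refine lintegral_congr_ae (ae_restrict_of_ae ?_)
  have h0 : ∀ᵐ y ∂F, F (Iio y) ≠ 1 := by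
    simpa [ae_iff] using measure_setOf_measure_Iio_eq_one F
  filter_upwards [h0] with y hy
  have h2 : ∀ u, (Iic u).indicator (fun y => (1 - F (Iio y))⁻¹) y
      = (Ici y).indicator (fun _ => (1 - F (Iio y))⁻¹) u := fun u => by simp [indicator]
  simp_rw [h2]
  rw [lintegral_indicator measurableSet_Ici, setLIntegral_const, ← compl_Iio,
    prob_compl_eq_one_sub measurableSet_Iio]
  refine ENNReal.inv_mul_cancel ?_ (by finiteness)
  exact (tsub_pos_of_lt (lt_of_le_of_ne prob_le_one hy)).ne'

/-- Additivity over disjoint intervals; finiteness is needed because `∞ - ∞ = 0`. -/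
lemma integratedHazard_sub_integratedHazard [IsProbabilityMeasure F] {a b u : ℝ≥0∞} (hab : a ≤ b)
    (hfin : integratedHazard F (min a u) ≠ ∞) :
    integratedHazard F (min b u) - integratedHazard F (min a u)
      = ∫⁻ y in Ioc a b ∩ Iic u, (1 - F (Iio y))⁻¹ ∂F := by
  have hset : Ioc 0 (min b u) = Ioc 0 (min a u) ∪ (Ioc a b ∩ Iic u) := by
    ext y
    simp only [mem_Ioc, mem_union, mem_inter_iff, mem_Iic, le_min_iff]
    constructor
    · rintro ⟨h0, hb, hu⟩
      rcases le_or_gt y a with h | h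
      · exact Or.inl ⟨h0, h, hu⟩
      · exact Or.inr ⟨⟨h, hb⟩, hu⟩
    · rintro (⟨h0, h, hu⟩ | ⟨⟨h, hb⟩, hu⟩)
      · exact ⟨h0, h.trans hab, hu⟩
      · exact ⟨bot_le.trans_lt h, hb, hu⟩
  have hdisj : Disjoint (Ioc 0 (min a u)) (Ioc a b ∩ Iic u) :=
    disjoint_left.2 fun y hy hy' => (hy.2.trans (min_le_left _ _)).not_gt hy'.1.1
  rw [integratedHazard, hset, lintegral_union (measurableSet_Ioc.inter measurableSet_Iic) hdisj]
  exact ENNReal.add_sub_cancel_left hfin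

end Hazard

/-! ### Paths of the arrival times and of the compensator. -/

section Paths

variable {Ω : Type*} {N : ℝ≥0 → Ω → ℕ}

lemma arrivalTime_mono (ω : Ω) : Monotone fun n => arrivalTime N n ω := fun _ _ h =>
  le_iInf₂ fun t ht => iInf₂_le t (h.trans ht)

lemma lt_arrivalTime_iff (hN : IsPointProcess N) (n : ℕ) (ω : Ω) (t : ℝ≥0) :
    t < arrivalTime N n ω ↔ N t ω < n := by
  rw [← not_le, arrivalTime_le_iff hN, not_le]

/-- Just before `T n` fewer than `n` points have arrived, so a unit jump leaves at most `n` at `T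
n`. -/
lemma arrivalTime_lt_succ (hN : IsPointProcess N) {n : ℕ} {ω : Ω} (h : arrivalTime N n ω < ∞) :
    arrivalTime N n ω < arrivalTime N (n + 1) ω := by
  lift arrivalTime N n ω to ℝ≥0 using h.ne with t ht
  rw [lt_arrivalTime_iff hN, Nat.lt_succ_iff]
  rcases eq_or_ne t 0 with rfl | ht0
  · simp [hN.zero]
  obtain ⟨s, hs, hst⟩ := hN.unit_jumps ω t (pos_iff_ne_zero.2 ht0)
  have : N s ω < n := by
    rw [← lt_arrivalTime_iff hN, ← ht]
    exact_mod_cast hs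
  omega

lemma tendsto_arrivalTime (hN : IsPointProcess N) (ω : Ω) :
    Tendsto (fun n => arrivalTime N n ω) atTop (𝓝 ∞) := by
  refine ENNReal.tendsto_nhds_top_iff_nnreal.2 fun x => ?_
  filter_upwards [eventually_gt_atTop (N x ω)] with n hn
  exact (lt_arrivalTime_iff hN n ω x).2 hn

variable (F : ℕ → Ω → Measure ℝ≥0∞)

/-- Truncated subtraction merges the three cases: `t - T n` is `0` for `t ≤ T n`, also when `T n =
∞`. -/
lemma compensatorTerm_eq (n : ℕ) (t : ℝ≥0) (ω : Ω) :
    compensatorTerm N F n t ω = integratedHazard (F n ω)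
      (min (t - arrivalTime N n ω) (waitingTime N n ω)) := by
  have hmin : min (t - arrivalTime N n ω) (waitingTime N n ω)
      = min (t : ℝ≥0∞) (arrivalTime N (n + 1) ω) - arrivalTime N n ω :=
    (Monotone.map_min (f := fun x : ℝ≥0∞ => x - arrivalTime N n ω)
      fun _ _ h => tsub_le_tsub_right h _).symm
  rw [hmin, compensatorTerm]
  split_ifs with h1 h2
  · rw [tsub_eq_zero_of_le ((min_le_left _ _).trans h1), integratedHazard_zero]
  · rw [min_eq_left h2]
  · rw [min_eq_right (not_le.1 h2).le]

lemma compensatorTerm_eq_zero {n : ℕ} {t : ℝ≥0} {ω : Ω} (h : t ≤ arrivalTime N n ω) :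
    compensatorTerm N F n t ω = 0 := by
  rw [compensatorTerm, if_pos h]

lemma compensatorTerm_mono (n : ℕ) (ω : Ω) : Monotone fun t => compensatorTerm N F n t ω := by
  intro s t h
  simp only [compensatorTerm_eq]
  refine integratedHazard_mono _ (min_le_min_right _ (tsub_le_tsub_right ?_ _))
  exact_mod_cast h

lemma continuousWithinAt_compensatorTerm (n : ℕ) (ω : Ω) [IsProbabilityMeasure (F n ω)]
    (t : ℝ≥0) : ContinuousWithinAt (fun u => compensatorTerm N F n u ω) (Ici t) t := by
  simp only [compensatorTerm_eq]
  have hc : Continuous fun u : ℝ≥0 =>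
      min ((u : ℝ≥0∞) - arrivalTime N n ω) (waitingTime N n ω) :=
    ((ENNReal.continuous_sub_right _).comp ENNReal.continuous_coe).min continuous_const
  refine ContinuousWithinAt.comp (f := fun u : ℝ≥0 => min ((u : ℝ≥0∞) - arrivalTime N n ω)
    (waitingTime N n ω)) (continuousWithinAt_integratedHazard (F n ω) _) (t := Ici (min ((t : ℝ≥0∞)
    - arrivalTime N n ω) (waitingTime N n ω))) hc.continuousWithinAt fun u hu => ?_
  have hu' : (t : ℝ≥0∞) ≤ u := by exact_mod_cast hu
  exact min_le_min_right _ (tsub_le_tsub_right hu' _)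

lemma compensator_zero (ω : Ω) : compensator N F 0 ω = 0 := by
  simp [compensator, compensatorTerm_eq_zero]

lemma compensator_mono (ω : Ω) : Monotone fun t => compensator N F t ω := fun _ _ h =>
  ENNReal.tsum_le_tsum fun n => compensatorTerm_mono F n ω h

lemma compensator_eq_sum (hN : IsPointProcess N) {t : ℝ≥0} {ω : Ω} {k : ℕ} (hk : N t ω ≤ k) :
    compensator N F t ω = ∑ n ∈ Finset.range (k + 1), compensatorTerm N F n t ω := by
  refine tsum_eq_sum fun n hn => compensatorTerm_eq_zero F ?_
  rw [Finset.mem_range, not_lt] at hn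
  exact ((lt_arrivalTime_iff hN n ω t).2 (by omega)).le

lemma continuousWithinAt_compensator (hN : IsPointProcess N) (ω : Ω)
    (hF : ∀ n, IsProbabilityMeasure (F n ω)) (t : ℝ≥0) :
    ContinuousWithinAt (fun u => compensator N F u ω) (Ici t) t := by
  -- On `[0, t + 1]` only the terms with `n ≤ N (t + 1)` can be nonzero, so the series is one fixed
  -- finite sum near `t`.
  have h : ∀ u ≤ t + 1, compensator N F u ω
      = ∑ n ∈ Finset.range (N (t + 1) ω + 1), compensatorTerm N F n u ω := fun u hu =>
    compensator_eq_sum F hN (hN.mono ω hu)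
  have hc : ContinuousWithinAt (fun u => ∑ n ∈ Finset.range (N (t + 1) ω + 1),
      compensatorTerm N F n u ω) (Ici t) t :=
    tendsto_finsetSum _ fun n _ => continuousWithinAt_compensatorTerm F n ω t
  refine hc.congr_of_eventuallyEq ?_ (h t le_self_add)
  filter_upwards [mem_nhdsWithin_of_mem_nhds (Iic_mem_nhds (lt_add_one t))] with u hu
  exact h u hu

end Paths

/-! ### Joint measurability and disintegration. -/

section Kernels

lemma measurable_measure_Iio {X : Type*} [MeasurableSpace X] {κ : X → Measure ℝ≥0∞}
    (hκ : Measurable κ) [hp : ∀ x, IsProbabilityMeasure (κ x)] :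
    Measurable fun p : X × ℝ≥0∞ => κ p.1 (Iio p.2) := by
  let K : Kernel X ℝ≥0∞ := ⟨κ, hκ⟩
  have : IsMarkovKernel K := ⟨hp⟩
  exact Kernel.measurable_kernel_prodMk_left (κ := K.comap Prod.fst measurable_fst)
    (t := {p : (X × ℝ≥0∞) × ℝ≥0∞ | p.2 < p.1.2})
    (measurableSet_lt measurable_snd (measurable_snd.comp measurable_fst))

lemma measurable_lintegral_hazardRate {X : Type*} [MeasurableSpace X] {κ : X → Measure ℝ≥0∞}
    (hκ : Measurable κ) [hp : ∀ x, IsProbabilityMeasure (κ x)] {a b u : X → ℝ≥0∞}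
    (ha : Measurable a) (hb : Measurable b) (hu : Measurable u) :
    Measurable fun x => ∫⁻ y in Ioc (a x) (b x) ∩ Iic (u x), (1 - κ x (Iio y))⁻¹ ∂κ x := by
  let K : Kernel X ℝ≥0∞ := ⟨κ, hκ⟩
  have : IsMarkovKernel K := ⟨hp⟩
  have hS : MeasurableSet {p : X × ℝ≥0∞ | p.2 ∈ Ioc (a p.1) (b p.1) ∩ Iic (u p.1)} :=
    ((measurableSet_lt (ha.comp measurable_fst) measurable_snd).inter
      (measurableSet_le measurable_snd (hb.comp measurable_fst))).inter
      (measurableSet_le measurable_snd (hu.comp measurable_fst))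
  have h : Measurable ({p : X × ℝ≥0∞ | p.2 ∈ Ioc (a p.1) (b p.1) ∩ Iic (u p.1)}.indicator
      fun p => (1 - κ p.1 (Iio p.2))⁻¹) :=
    (measurable_const.sub (measurable_measure_Iio hκ)).inv.indicator hS
  convert h.lintegral_kernel_prod_right' (κ := K) using 2 with x
  rw [← lintegral_indicator (measurableSet_Ioc.inter measurableSet_Iic)]
  rfl

lemma measurable_integratedHazard {X : Type*} [MeasurableSpace X] {κ : X → Measure ℝ≥0∞}
    (hκ : Measurable κ) [hp : ∀ x, IsProbabilityMeasure (κ x)] {b : X → ℝ≥0∞}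
    (hb : Measurable b) : Measurable fun x => integratedHazard (κ x) (b x) := by
  simpa [integratedHazard] using
    measurable_lintegral_hazardRate hκ (a := fun _ => 0) (u := fun _ => ∞)
      measurable_const hb measurable_const

/-- Agreement on rectangles identifies the joint law of `(φ, U)` with the composition product. `X`
and `Y` are kept apart so that `φ` can be the identity from `Ω` with its full σ-algebra to `Ω` with
a smaller one. -/
lemma lintegral_eq_lintegral_kernel {X Y E : Type*} [MeasurableSpace X] [MeasurableSpace Y]
    [MeasurableSpace E] {μ : Measure Y} [IsFiniteMeasure μ] {φ : Y → X} (hφ : Measurable φ)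
    {U : Y → E} (hU : Measurable U) (κ : Kernel X E) [IsMarkovKernel κ]
    (h : ∀ s t, MeasurableSet s → MeasurableSet t →
      ∫⁻ y in φ ⁻¹' s, κ (φ y) t ∂μ = μ (φ ⁻¹' s ∩ U ⁻¹' t))
    {f : X × E → ℝ≥0∞} (hf : Measurable f) :
    ∫⁻ y, f (φ y, U y) ∂μ = ∫⁻ y, ∫⁻ u, f (φ y, u) ∂κ (φ y) ∂μ := by
  have hmap : (μ.map φ) ⊗ₘ κ = μ.map fun y => (φ y, U y) := by
    refine Measure.ext_prod fun {s t} hs ht => ?_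
    rw [Measure.compProd_apply_prod hs ht, Measure.map_apply (hφ.prodMk hU) (hs.prod ht),
      setLIntegral_map hs (κ.measurable_coe ht) hφ, h s t hs ht]
    rfl
  rw [← lintegral_map hf (hφ.prodMk hU), ← hmap, Measure.lintegral_compProd hf,
    lintegral_map hf.lintegral_kernel_prod_right' hφ]

/-- The disintegration formula for a regular conditional distribution. -/
lemma IsRegularCondDistrib.setLIntegral_eq {Ω : Type*} {𝓖 m : MeasurableSpace Ω}
    {P : Measure Ω} [IsProbabilityMeasure P] {U : Ω → ℝ≥0∞} {S : Set Ω} {κ : Ω → Measure ℝ≥0∞}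
    (hκ : IsRegularCondDistrib P 𝓖 U S κ) (h𝓖 : 𝓖 ≤ m) (hU : Measurable[m] U)
    (hS : MeasurableSet[𝓖] S) {f : Ω × ℝ≥0∞ → ℝ≥0∞}
    (hf : Measurable[𝓖.prod inferInstance] f) :
    ∫⁻ ω in S, f (ω, U ω) ∂P = ∫⁻ ω in S, ∫⁻ u, f (ω, u) ∂κ ω ∂P := by
  let K : @Kernel Ω ℝ≥0∞ 𝓖 _ := @Kernel.mk Ω ℝ≥0∞ 𝓖 _ κ hκ.measurable
  have hK : @IsMarkovKernel Ω ℝ≥0∞ 𝓖 _ K := @IsMarkovKernel.mk _ _ 𝓖 _ _ hκ.isProbabilityMeasure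
  have hp := hκ.isProbabilityMeasure
  refine @lintegral_eq_lintegral_kernel Ω Ω ℝ≥0∞ 𝓖 m _ (P.restrict S) _ id
    (measurable_id'' h𝓖) U hU K hK (fun s t hs ht => ?_) f hf
  have hint : Integrable ((U ⁻¹' t).indicator fun _ => (1 : ℝ)) P :=
    (integrable_const 1).indicator (hU ht)
  have hsS : MeasurableSet[𝓖] (s ∩ S) := hs.inter hS
  rw [preimage_id, Measure.restrict_restrict (h𝓖 _ hs),
    Measure.restrict_apply ((h𝓖 _ hs).inter (hU ht))]
  have hmeas : Measurable fun ω => κ ω t :=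
    ((Measure.measurable_coe ht).comp hκ.measurable).mono h𝓖 le_rfl
  -- Testing on `s ∩ S`, which lies in `𝓖`, suffices: the kernel is a version of the conditional
  -- probability only on `S`.
  have h1 := setIntegral_condExp h𝓖 hint hsS
  have h2 : ∫ ω in s ∩ S, (P⟦U ⁻¹' t | 𝓖⟧) ω ∂P = ∫ ω in s ∩ S, (κ ω t).toReal ∂P := by
    refine setIntegral_congr_ae (h𝓖 _ hsS) ?_
    filter_upwards [hκ.condProb t ht] with ω hω hωS
    exact (hω hωS.2).symm
  rw [h2, integral_toReal hmeas.aemeasurable (ae_of_all _ fun ω => measure_lt_top _ _),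
    integral_indicator (hU ht), setIntegral_const, smul_eq_mul, mul_one, Measure.real,
    Measure.restrict_apply' (h𝓖 _ hsS)] at h1
  have h3 : ∫⁻ ω in s ∩ S, κ ω t ∂P ≠ ∞ := by
    refine ne_top_of_le_ne_top (measure_ne_top P (s ∩ S)) ?_
    rw [← setLIntegral_one]
    exact lintegral_mono fun ω => prob_le_one
  rw [ENNReal.toReal_eq_toReal_iff' h3 (measure_ne_top _ _)] at h1
  change ∫⁻ ω in s ∩ S, κ ω t ∂P = _
  rw [h1]
  congr 1
  ext ω
  simp only [mem_inter_iff]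
  tauto

end Kernels

/-! ### Predictable sets and processes after a stopping time. -/

section Predictable

variable {Ω : Type*} {m : MeasurableSpace Ω} {𝓕 : Filtration ℝ≥0 m} {τ : Ω → ℝ≥0∞}

lemma measurable_of_isStoppingTime (hτ : IsStoppingTime 𝓕 τ) :
    Measurable[hτ.measurableSpace] τ := by
  refine measurable_of_Iic fun i => ?_
  cases i with
  | top => simp
  | coe i => exact hτ.measurableSet_le' i

lemma exists_nnrat_btwn_iff {x : ℝ≥0∞} {t : ℝ≥0} :
    x < t ↔ ∃ q : ℚ≥0, x ≤ (q : ℝ≥0) ∧ (q : ℝ≥0) < t := by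
  constructor
  · intro h
    obtain ⟨q, hq0, hq, hqt⟩ := ENNReal.lt_iff_exists_rat_btwn.1 h
    lift q to ℚ≥0 using hq0
    have : Real.toNNReal ((q : ℚ) : ℝ) = (q : ℝ≥0) := by
      ext
      rw [Real.coe_toNNReal _ (by positivity)]
      norm_cast
    rw [this] at hq hqt
    exact ⟨q, hq.le, by exact_mod_cast hqt⟩
  · rintro ⟨q, h1, h2⟩
    exact h1.trans_lt (by exact_mod_cast h2)

/-- The set is a countable union of predictable rectangles `(q, ∞) × (B ∩ {τ ≤ q})`; that `B ∩ {τ ≤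
q}` belongs to `𝓕 q` is the meaning of `B` lying in the `τ`-past. -/
lemma measurableSet_predictable_inter (hτ : IsStoppingTime 𝓕 τ) {B : Set Ω}
    (hB : MeasurableSet[hτ.measurableSpace] B) :
    MeasurableSet[𝓕.predictable] {p : ℝ≥0 × Ω | τ p.2 < p.1 ∧ p.2 ∈ B} := by
  have : {p : ℝ≥0 × Ω | τ p.2 < p.1 ∧ p.2 ∈ B}
      = ⋃ q : ℚ≥0, Ioi (q : ℝ≥0) ×ˢ (B ∩ {ω | τ ω ≤ (q : ℝ≥0)}) := by
    ext p
    simp only [exists_nnrat_btwn_iff, mem_ofPred_eq, mem_iUnion, mem_prod, mem_Ioi, mem_inter_iff]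
    constructor
    · rintro ⟨⟨q, h1, h2⟩, h3⟩
      exact ⟨q, h2, h3, h1⟩
    · rintro ⟨q, h2, h3, h1⟩
      exact ⟨⟨q, h1, h2⟩, h3⟩
  rw [this]
  exact MeasurableSet.iUnion fun q => measurableSet_predictable_Ioi_prod (hB.2 q)

lemma measurableSet_predictable_le (hτ : IsStoppingTime 𝓕 τ) :
    MeasurableSet[𝓕.predictable] {p : ℝ≥0 × Ω | (p.1 : ℝ≥0∞) ≤ τ p.2} := by
  have := (measurableSet_predictable_inter hτ (B := univ) MeasurableSet.univ).compl
  convert this using 1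
  ext p; simp

/-- A process that vanishes up to a stopping time `τ`, and is a measurable function of time and of
the `τ`-past afterwards, is predictable. -/
lemma measurable_predictable_ite (hτ : IsStoppingTime 𝓕 τ) {g : Ω × ℝ≥0 → ℝ≥0∞}
    (hg : Measurable[hτ.measurableSpace.prod inferInstance] g) :
    Measurable[𝓕.predictable] fun p : ℝ≥0 × Ω =>
      open Classical in if (p.1 : ℝ≥0∞) ≤ τ p.2 then 0 else g (p.2, p.1) := by
  classical
  let : MeasurableSpace (ℝ≥0 × Ω) := 𝓕.predictable
  set s := {p : ℝ≥0 × Ω | (p.1 : ℝ≥0∞) ≤ τ p.2}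
  have htime : Measurable fun p : ℝ≥0 × Ω => p.1 := by
    refine measurable_of_Ioi fun a => ?_
    have := measurableSet_predictable_Ioi_prod (𝓕 := 𝓕) (i := a) (s := univ) MeasurableSet.univ
    rwa [prod_univ] at this
  -- Strictly after `τ`, the projection to `Ω` is measurable from the predictable σ-algebra to the
  -- `τ`-past.
  have hspace : Measurable[_, hτ.measurableSpace] fun p : ↥sᶜ => (p : ℝ≥0 × Ω).2 := by
    intro B hB
    refine ⟨_, measurableSet_predictable_inter hτ hB, ?_⟩
    ext ⟨p, hp⟩
    have hp' : τ p.2 < p.1 := not_le.1 hp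
    simp [hp']
  have hpair : Measurable[_, hτ.measurableSpace.prod inferInstance]
      fun p : ↥sᶜ => ((p : ℝ≥0 × Ω).2, (p : ℝ≥0 × Ω).1) :=
    hspace.prodMk (htime.comp measurable_subtype_coe)
  have h0 : Measurable fun _ : ↥s => (0 : ℝ≥0∞) := measurable_const
  exact h0.dite (hg.comp hpair) (measurableSet_predictable_le hτ)

end Predictable

/-! ### From equal mean increments to martingales. -/

section Martingales

variable {Ω : Type*} {m : MeasurableSpace Ω}

lemma setLIntegral_toReal_sub {P : Measure Ω} {M : Ω → ℕ} {B : Ω → ℝ≥0∞} (hM : Measurable M)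
    (hB : Measurable B) (hMi : ∫⁻ ω, (M ω : ℝ≥0∞) ∂P ≠ ∞) (hBi : ∫⁻ ω, B ω ∂P ≠ ∞) :
    Integrable (fun ω => (M ω : ℝ) - (B ω).toReal) P ∧ ∀ C,
      ∫ ω in C, ((M ω : ℝ) - (B ω).toReal) ∂P
        = (∫⁻ ω in C, (M ω : ℝ≥0∞) ∂P).toReal - (∫⁻ ω in C, B ω ∂P).toReal := by
  have hM' : Measurable fun ω => (M ω : ℝ≥0∞) := (measurable_from_top (f := Nat.cast)).comp hM
  have h1 : Integrable (fun ω => (M ω : ℝ)) P := by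
    simpa using integrable_toReal_of_lintegral_ne_top hM'.aemeasurable hMi
  have h2 := integrable_toReal_of_lintegral_ne_top hB.aemeasurable hBi
  refine ⟨h1.sub h2, fun C => ?_⟩
  rw [integral_sub h1.integrableOn h2.integrableOn,
    integral_toReal hB.aemeasurable (ae_restrict_of_ae (ae_lt_top hB hBi)),
    ← integral_toReal hM'.aemeasurable (ae_of_all _ fun ω => ENNReal.natCast_lt_top _)]
  simp

/-- Monotone processes with the same conditional mean increments differ by a martingale. -/
lemma martingale_compensated {𝓕 : Filtration ℝ≥0 m} {P : Measure Ω} [IsFiniteMeasure P]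
    {M : ℝ≥0 → Ω → ℕ} {B : ℝ≥0 → Ω → ℝ≥0∞} (hM : ∀ t, Measurable[𝓕 t] (M t))
    (hB : ∀ t, Measurable[𝓕 t] (B t)) (hMmono : ∀ ω, Monotone fun t => M t ω)
    (hBmono : ∀ ω, Monotone fun t => B t ω)
    (hincr : ∀ s t, s ≤ t → ∀ C, MeasurableSet[𝓕 s] C →
      ∫⁻ ω in C, ((M t ω : ℝ≥0∞) - M s ω) ∂P = ∫⁻ ω in C, (B t ω - B s ω) ∂P)
    (hMi : ∀ t, ∫⁻ ω, (M t ω : ℝ≥0∞) ∂P ≠ ∞) (hBi : ∀ t, ∫⁻ ω, B t ω ∂P ≠ ∞) :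
    Martingale (compensated M B) 𝓕 P := by
  have hM' : ∀ t, Measurable (M t) := fun t => (hM t).mono (𝓕.le t) le_rfl
  have hB' : ∀ t, Measurable (B t) := fun t => (hB t).mono (𝓕.le t) le_rfl
  have hMe : ∀ t, Measurable fun ω => (M t ω : ℝ≥0∞) := fun t =>
    (measurable_from_top (f := Nat.cast)).comp (hM' t)
  have key := fun t => setLIntegral_toReal_sub (hM' t) (hB' t) (hMi t) (hBi t)
  have hadapted : StronglyAdapted 𝓕 (compensated M B) := fun t =>
    (((measurable_from_top (f := Nat.cast)).comp (hM t)).sub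
      (hB t).ennreal_toReal).stronglyMeasurable
  have hfin : ∀ (f : Ω → ℝ≥0∞) (C : Set Ω), ∫⁻ ω, f ω ∂P ≠ ∞ → ∫⁻ ω in C, f ω ∂P ≠ ∞ :=
    fun f C h => ne_top_of_le_ne_top h (setLIntegral_le_lintegral _ _)
  refine ⟨hadapted, fun s t hst => ?_⟩
  refine (ae_eq_condExp_of_forall_setIntegral_eq (𝓕.le s) (key t).1
    (fun C _ _ => (key s).1.integrableOn) (fun C hC _ => ?_)
    (hadapted s).aestronglyMeasurable).symm
  have hadd : ∀ f g : Ω → ℝ≥0∞, Measurable f → Measurable g → f ≤ g →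
      ∫⁻ ω in C, g ω ∂P = ∫⁻ ω in C, f ω ∂P + ∫⁻ ω in C, (g ω - f ω) ∂P :=
    fun f g hf hg hfg => by
      rw [← lintegral_add_left hf]
      exact lintegral_congr fun ω => (add_tsub_cancel_of_le (hfg ω)).symm
  have h1 := hadd _ _ (hMe s) (hMe t) fun ω => Nat.cast_le.2 (hMmono ω hst)
  have h2 := hadd _ _ (hB' s) (hB' t) fun ω => hBmono ω hst
  -- Both means at `t` now exceed those at `s` by the same finite amount, which cancels in the
  -- difference.
  rw [← hincr s t hst C hC] at h2
  have h3 : ∫⁻ ω in C, ((M t ω : ℝ≥0∞) - M s ω) ∂P ≠ ∞ :=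
    ne_top_of_le_ne_top (hfin _ C (hMi t)) (h1 ▸ le_add_self)
  change ∫ ω in C, ((M s ω : ℝ) - (B s ω).toReal) ∂P
    = ∫ ω in C, ((M t ω : ℝ) - (B t ω).toReal) ∂P
  rw [(key s).2, (key t).2, h1, h2, ENNReal.toReal_add (hfin _ C (hMi s)) h3,
    ENNReal.toReal_add (hfin _ C (hBi s)) h3]
  ring

end Martingales

/-! ### The internal history between consecutive arrivals. -/

section History

variable {Ω : Type*} {m : MeasurableSpace Ω} {𝓕 : Filtration ℝ≥0 m} {N : ℝ≥0 → Ω → ℕ}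

lemma IsInternalHistory.measurable (h𝓕 : IsInternalHistory 𝓕 N) (t : ℝ≥0) :
    Measurable[𝓕 t] (N t) := by
  rw [measurable_iff_comap_le, h𝓕 t]
  exact le_sup_of_le_right (le_iSup₂_of_le t (mem_Iic.2 le_rfl) le_rfl)

/-- For `k ≤ n`, `{N r ∧ n ≥ k} = {T k ≤ r}` belongs to the past of `T k`, hence of `T n`; for `k >
n` the event is empty. -/
lemma measurable_min_arrivalTime (hN : IsPointProcess N) (h𝓕 : IsInternalHistory 𝓕 N) (n : ℕ)
    (r : ℝ≥0) :
    Measurable[(isStoppingTime_arrivalTime hN h𝓕 n).measurableSpace]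
      fun ω => min (N r ω) n := by
  refine measurable_of_Ici fun k => ?_
  rcases le_or_gt k n with hk | hk
  · have h := IsStoppingTime.measurableSpace_mono (isStoppingTime_arrivalTime hN h𝓕 k)
      (isStoppingTime_arrivalTime hN h𝓕 n) (fun ω => arrivalTime_mono ω hk) _
      ((isStoppingTime_arrivalTime hN h𝓕 k).measurableSet_le' r)
    convert h using 1
    ext ω
    have := arrivalTime_le_iff hN k ω r
    simp only [mem_preimage, mem_Ici, le_min_iff, hk, and_true]
    exact this.symm
  · convert MeasurableSet.empty using 1
    ext ω
    simp [hk]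

/-- Before `T (n + 1)`, the history at time `s` is contained in the history at time `T n`. -/
lemma exists_inter_lt_arrivalTime_eq (hN : IsPointProcess N) (h𝓕 : IsInternalHistory 𝓕 N)
    (n : ℕ) (s : ℝ≥0) {C : Set Ω} (hC : MeasurableSet[𝓕 s] C) :
    ∃ D, MeasurableSet[(isStoppingTime_arrivalTime hN h𝓕 n).measurableSpace] D ∧
      ∀ ω, s < arrivalTime N (n + 1) ω → (ω ∈ D ↔ ω ∈ C) := by
  set 𝓖 := (isStoppingTime_arrivalTime hN h𝓕 n).measurableSpace
  let E := {ω | s < arrivalTime N (n + 1) ω}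
  -- The sets agreeing on `E` with an event of `𝓖` form a σ-algebra, so only the generators of `𝓕 s`
  -- matter: initial events already lie in `𝓖`, and `N r = N r ∧ n` on `E` for `r ≤ s`.
  have hle : 𝓕 s ≤ (𝓖.comap (Subtype.val : E → Ω)).map Subtype.val := by
    rw [h𝓕 s]
    refine sup_le (fun A hA => ⟨A, ?_, rfl⟩) (iSup₂_le fun r hr => ?_)
    · exact (isStoppingTime_arrivalTime hN h𝓕 n).le_measurableSpace_of_const_le
        (i := 0) (fun ω => bot_le) A hA
    · rintro A ⟨B, -, rfl⟩
      refine ⟨_, measurable_min_arrivalTime hN h𝓕 n r (MeasurableSet.of_discrete (s := B)), ?_⟩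
      ext ⟨ω, hω⟩
      have h1 : N s ω < n + 1 := (lt_arrivalTime_iff hN _ _ _).1 hω
      have h2 : N r ω ≤ N s ω := hN.mono ω hr
      have h3 : min (N r ω) n = N r ω := by omega
      simp [h3]
  obtain ⟨D, hD, hDC⟩ := hle C hC
  exact ⟨D, hD, fun ω hω => by simpa using congrArg (fun A : Set E => (⟨ω, hω⟩ : E) ∈ A) hDC⟩

variable {P : Measure Ω} {F : ℕ → Ω → Measure ℝ≥0∞}

lemma measurable_waitingTime (hN : IsPointProcess N) (h𝓕 : IsInternalHistory 𝓕 N) (n : ℕ) :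
    Measurable[(isStoppingTime_arrivalTime hN h𝓕 (n + 1)).measurableSpace]
      (waitingTime N n) := by
  have h := IsStoppingTime.measurableSpace_mono (isStoppingTime_arrivalTime hN h𝓕 n)
    (isStoppingTime_arrivalTime hN h𝓕 (n + 1)) (fun ω => arrivalTime_mono ω n.le_succ)
  exact (measurable_of_isStoppingTime (isStoppingTime_arrivalTime hN h𝓕 (n + 1))).sub
    ((measurable_of_isStoppingTime (isStoppingTime_arrivalTime hN h𝓕 n)).mono h le_rfl)

lemma measurable_predictable_compensatorTerm (hN : IsPointProcess N)
    (h𝓕 : IsInternalHistory 𝓕 N) (n : ℕ)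
    (hF : IsRegularCondDistrib P (isStoppingTime_arrivalTime hN h𝓕 n).measurableSpace
      (waitingTime N n) {ω | arrivalTime N n ω < ∞} (F n)) :
    Measurable[𝓕.predictable] fun p : ℝ≥0 × Ω => compensatorTerm N F n p.1 p.2 := by
  classical
  have hp := hF.isProbabilityMeasure
  set hτ := isStoppingTime_arrivalTime hN h𝓕 n
  set hτ' := isStoppingTime_arrivalTime hN h𝓕 (n + 1)
  have hle : hτ.measurableSpace ≤ hτ'.measurableSpace :=
    IsStoppingTime.measurableSpace_mono hτ hτ' fun ω => arrivalTime_mono ω n.le_succ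
  have h1 : Measurable[hτ.measurableSpace.prod inferInstance] fun p : Ω × ℝ≥0 =>
      integratedHazard (F n p.1) ((p.2 : ℝ≥0∞) - arrivalTime N n p.1) := by
    let : MeasurableSpace Ω := hτ.measurableSpace
    exact measurable_integratedHazard (hp := fun p => hp p.1) (hF.measurable.comp measurable_fst)
      ((measurable_coe_nnreal_ennreal.comp measurable_snd).sub
        ((measurable_of_isStoppingTime hτ).comp measurable_fst))
  have h2 : Measurable[hτ'.measurableSpace.prod inferInstance] fun p : Ω × ℝ≥0 =>
      integratedHazard (F n p.1) (waitingTime N n p.1) := by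
    let : MeasurableSpace Ω := hτ'.measurableSpace
    exact measurable_integratedHazard (hp := fun p => hp p.1) ((hF.measurable.mono hle le_rfl).comp measurable_fst)
      ((measurable_waitingTime hN h𝓕 n).comp measurable_fst)
  let : MeasurableSpace (ℝ≥0 × Ω) := 𝓕.predictable
  -- Up to `T (n + 1)` the term is a function of time and the past of `T n`; afterwards it is a
  -- constant known at `T (n + 1)`.
  have h3 := @Measurable.ite _ _ _ _ _ _ _ (fun _ => Classical.propDecidable _)
    (measurableSet_predictable_le hτ') (measurable_predictable_ite hτ h1)
    (measurable_predictable_ite hτ' h2)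
  convert h3 using 2 with p
  have hmono : arrivalTime N n p.2 ≤ arrivalTime N (n + 1) p.2 := arrivalTime_mono p.2 n.le_succ
  simp only [compensatorTerm, waitingTime]
  split_ifs with h4 h5 <;> first | rfl | exact absurd (h4.trans hmono) h5

variable [IsProbabilityMeasure P]

/-- The mean of an increment of the `n`-th term of the compensator, in the form of an integral
with respect to the conditional distribution. -/
lemma setLIntegral_hazardRate_waitingTime (hN : IsPointProcess N) (h𝓕 : IsInternalHistory 𝓕 N)
    (n : ℕ) (hF : IsRegularCondDistrib P (isStoppingTime_arrivalTime hN h𝓕 n).measurableSpace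
      (waitingTime N n) {ω | arrivalTime N n ω < ∞} (F n)) {s t : ℝ≥0} {C : Set Ω}
    (hC : MeasurableSet[𝓕 s] C) :
    ∫⁻ ω in C, ∫⁻ y in Ioc (s - arrivalTime N n ω) (t - arrivalTime N n ω)
      ∩ Iic (waitingTime N n ω), (1 - F n ω (Iio y))⁻¹ ∂F n ω ∂P
      = ∫⁻ ω in C, {ω | N s ω ≤ n ∧ n < N t ω}.indicator 1 ω ∂P := by
  have hp := hF.isProbabilityMeasure
  set hτ := isStoppingTime_arrivalTime hN h𝓕 n
  have h𝓖 := hτ.measurableSpace_le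
  have hT := measurable_of_isStoppingTime hτ
  set S := {ω | arrivalTime N n ω < ∞}
  have hS : MeasurableSet[hτ.measurableSpace] S := hT measurableSet_Iio
  have hU : Measurable (waitingTime N n) := (measurable_waitingTime hN h𝓕 n).mono
    (isStoppingTime_arrivalTime hN h𝓕 (n + 1)).measurableSpace_le le_rfl
  obtain ⟨D, hD, hDC⟩ := exists_inter_lt_arrivalTime_eq hN h𝓕 n s hC
  set a : Ω → ℝ≥0∞ := fun ω => s - arrivalTime N n ω
  set b : Ω → ℝ≥0∞ := fun ω => t - arrivalTime N n ω
  have ha : Measurable[hτ.measurableSpace] a := measurable_const.sub hT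
  have hb : Measurable[hτ.measurableSpace] b := measurable_const.sub hT
  -- `f` is the hazard in `(a, b]` up to `u`, `g` the indicator of `u ∈ (a, b]`, both cut to `D`.
  -- Their means under `F n ω` agree by the one-variable identity, so disintegration makes them
  -- agree at `u = U (n + 1)`.
  let f : Ω × ℝ≥0∞ → ℝ≥0∞ := (D ×ˢ univ).indicator fun p =>
    ∫⁻ y in Ioc (a p.1) (b p.1) ∩ Iic p.2, (1 - F n p.1 (Iio y))⁻¹ ∂F n p.1
  let g : Ω × ℝ≥0∞ → ℝ≥0∞ := {p | p.1 ∈ D ∧ p.2 ∈ Ioc (a p.1) (b p.1)}.indicator 1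
  have hf : Measurable[hτ.measurableSpace.prod inferInstance] f := by
    let : MeasurableSpace Ω := hτ.measurableSpace
    exact (measurable_lintegral_hazardRate (hp := fun p => hp p.1) (hF.measurable.comp measurable_fst)
      (ha.comp measurable_fst) (hb.comp measurable_fst) measurable_snd).indicator
      (hD.prod MeasurableSet.univ)
  have hg : Measurable[hτ.measurableSpace.prod inferInstance] g := by
    let : MeasurableSpace Ω := hτ.measurableSpace
    refine measurable_one.indicator ((measurable_fst hD).inter ?_)
    exact (measurableSet_lt (ha.comp measurable_fst) measurable_snd).inter
      (measurableSet_le measurable_snd (hb.comp measurable_fst))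
  have hfg : ∀ ω, ∫⁻ u, f (ω, u) ∂F n ω = ∫⁻ u, g (ω, u) ∂F n ω := fun ω => by
    by_cases hω : ω ∈ D
    · have h1 : ∀ u, f (ω, u) = ∫⁻ y in Ioc (a ω) (b ω) ∩ Iic u, (1 - F n ω (Iio y))⁻¹ ∂F n ω :=
        fun u => by simp [f, hω]
      have h2 : ∀ u, g (ω, u) = (Ioc (a ω) (b ω)).indicator 1 u := fun u => by
        simp [g, hω, indicator]
      simp_rw [h1, h2]
      rw [lintegral_lintegral_hazardRate, lintegral_indicator_one measurableSet_Ioc]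
    · simp [f, g, hω]
  have hkey : ∫⁻ ω in S, f (ω, waitingTime N n ω) ∂P
      = ∫⁻ ω in S, g (ω, waitingTime N n ω) ∂P := by
    rw [hF.setLIntegral_eq h𝓖 hU hS hf, hF.setLIntegral_eq h𝓖 hU hS hg]
    exact lintegral_congr hfg
  -- Both integrands vanish off `{T n < ∞, s < T (n + 1)}`; there `C` and `D` coincide, so
  -- exchanging them and restricting to `S` is harmless.
  have hempty : ∀ ω, ¬ (arrivalTime N n ω < ∞ ∧ s < arrivalTime N (n + 1) ω) →
      Ioc (a ω) (b ω) ∩ Iic (waitingTime N n ω) = ∅ := fun ω hω => by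
    rw [not_and_or, not_lt, not_lt, top_le_iff] at hω
    rcases hω with hω | hω
    · simp [a, b, hω]
    · ext y
      simp only [mem_inter_iff, mem_Ioc, mem_Iic, mem_empty_iff_false, iff_false]
      rintro ⟨⟨h1, -⟩, h2⟩
      exact (h1.trans_le h2).not_ge (tsub_le_tsub_right hω _)
  have hCm := 𝓕.le s C hC
  rw [← lintegral_indicator hCm, ← lintegral_indicator hCm]
  rw [← lintegral_indicator (h𝓖 S hS), ← lintegral_indicator (h𝓖 S hS)] at hkey
  convert hkey using 2 with ω ω
  · ext ω
    by_cases hω : arrivalTime N n ω < ∞ ∧ s < arrivalTime N (n + 1) ω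
    · have h1 : ω ∈ S := hω.1
      have h2 := hDC ω hω.2
      by_cases h3 : ω ∈ C <;> simp [h1, h2, h3, f, a, b]
    · have h1 := hempty ω hω
      have h2 : C.indicator (fun ω => ∫⁻ y in Ioc (a ω) (b ω) ∩ Iic (waitingTime N n ω),
          (1 - F n ω (Iio y))⁻¹ ∂F n ω) ω = 0 := by simp [indicator, h1]
      rw [h2]
      simp only [indicator, f, h1, Measure.restrict_empty, lintegral_zero_measure, ite_self]
  · ext ω
    by_cases hω : arrivalTime N n ω < ∞ ∧ s < arrivalTime N (n + 1) ω
    · have h1 : ω ∈ S := hω.1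
      have h2 := hDC ω hω.2
      have h3 : N s ω ≤ n := Nat.lt_succ_iff.1 ((lt_arrivalTime_iff hN _ _ _).1 hω.2)
      have h4 := arrivalTime_lt_succ hN hω.1
      -- Since `a` is truncated at `0`, both `s < T (n + 1)` and `T n < T (n + 1)` are needed.
      have h5 : a ω < waitingTime N n ω := by
        simp only [a, waitingTime]
        rw [lt_tsub_iff_right, tsub_add_eq_max]
        exact max_lt hω.2 h4
      have h6 : waitingTime N n ω ≤ b ω ↔ n < N t ω := by
        simp only [b, waitingTime]
        rw [tsub_le_iff_right, tsub_add_eq_max, le_max_iff, or_iff_left h4.not_ge,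
          arrivalTime_le_iff hN, Nat.succ_le_iff]
      by_cases h7 : ω ∈ C <;> simp [h1, h2, h3, h5, h6, h7, g, indicator]
    · have h1 := hempty ω hω
      have h2 : ¬ (N s ω ≤ n ∧ n < N t ω) := fun h => hω
        ⟨((arrivalTime_le_iff hN n ω t).2 h.2.le).trans_lt ENNReal.coe_lt_top,
          (lt_arrivalTime_iff hN _ _ _).2 (Nat.lt_succ_iff.2 h.1)⟩
      have h3 : waitingTime N n ω ∉ Ioc (a ω) (b ω) := fun h => by
        have : waitingTime N n ω ∈ Ioc (a ω) (b ω) ∩ Iic (waitingTime N n ω) := ⟨h, self_mem_Iic⟩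
        simp [h1] at this
      have h4 : g (ω, waitingTime N n ω) = 0 := indicator_of_notMem (fun h => h3 h.2) _
      simp only [indicator, mem_ofPred_eq, h2, h4, if_false, ite_self]

end History

/-! ### Mean increments of the compensator. -/

section Increments

variable {Ω : Type*} {m : MeasurableSpace Ω} {𝓕 : Filtration ℝ≥0 m} {N : ℝ≥0 → Ω → ℕ}
  {P : Measure Ω} {F : ℕ → Ω → Measure ℝ≥0∞}

lemma measurable_compensatorTerm (hN : IsPointProcess N) (h𝓕 : IsInternalHistory 𝓕 N) (n : ℕ)
    (hF : IsRegularCondDistrib P (isStoppingTime_arrivalTime hN h𝓕 n).measurableSpace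
      (waitingTime N n) {ω | arrivalTime N n ω < ∞} (F n)) (t : ℝ≥0) :
    Measurable[𝓕 t] (compensatorTerm N F n t) := by
  have h : IsStronglyPredictable 𝓕 (compensatorTerm N F n) :=
    (measurable_predictable_compensatorTerm hN h𝓕 n hF).stronglyMeasurable
  exact (h.stronglyAdapted t).measurable

lemma measurable_predictable_compensator (hN : IsPointProcess N) (h𝓕 : IsInternalHistory 𝓕 N)
    (hF : ∀ n, IsRegularCondDistrib P (isStoppingTime_arrivalTime hN h𝓕 n).measurableSpace
      (waitingTime N n) {ω | arrivalTime N n ω < ∞} (F n)) :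
    Measurable[𝓕.predictable] fun p : ℝ≥0 × Ω => compensator N F p.1 p.2 := by
  have h := fun n => measurable_predictable_compensatorTerm hN h𝓕 n (hF n)
  generalize 𝓕.predictable = mp at h ⊢
  exact Measurable.tsum h

variable [IsProbabilityMeasure P]

/-- With `s = 0` the mean is `P(n < N t)`. The subtracted hazard is then `0`, so no finiteness has
to be known beforehand; this bound is what provides it. -/
lemma lintegral_compensatorTerm_le_one (hN : IsPointProcess N) (h𝓕 : IsInternalHistory 𝓕 N)
    (n : ℕ) (hF : IsRegularCondDistrib P (isStoppingTime_arrivalTime hN h𝓕 n).measurableSpace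
      (waitingTime N n) {ω | arrivalTime N n ω < ∞} (F n)) (t : ℝ≥0) :
    ∫⁻ ω, compensatorTerm N F n t ω ∂P ≤ 1 := by
  have hp := hF.isProbabilityMeasure
  have h := setLIntegral_hazardRate_waitingTime hN h𝓕 n hF (s := 0) (t := t) MeasurableSet.univ
  simp only [Measure.restrict_univ] at h
  have h1 : ∀ ω, compensatorTerm N F n t ω
      = ∫⁻ y in Ioc ((0 : ℝ≥0) - arrivalTime N n ω) (t - arrivalTime N n ω)
        ∩ Iic (waitingTime N n ω), (1 - F n ω (Iio y))⁻¹ ∂F n ω := fun ω => by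
    rw [← integratedHazard_sub_integratedHazard (F n ω) (by simp) (by simp), compensatorTerm_eq]
    simp
  simp_rw [h1]
  rw [h]
  calc _ ≤ ∫⁻ _, 1 ∂P := lintegral_mono fun ω => indicator_le_self' (fun _ _ => zero_le_one) ω
    _ = 1 := by simp

lemma ae_compensatorTerm_lt_top (hN : IsPointProcess N) (h𝓕 : IsInternalHistory 𝓕 N) (n : ℕ)
    (hF : IsRegularCondDistrib P (isStoppingTime_arrivalTime hN h𝓕 n).measurableSpace
      (waitingTime N n) {ω | arrivalTime N n ω < ∞} (F n)) (t : ℝ≥0) :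
    ∀ᵐ ω ∂P, compensatorTerm N F n t ω < ∞ :=
  ae_lt_top ((measurable_compensatorTerm hN h𝓕 n hF t).mono (𝓕.le t) le_rfl)
    (ne_top_of_le_ne_top ENNReal.one_ne_top (lintegral_compensatorTerm_le_one hN h𝓕 n hF t))

lemma setLIntegral_compensatorTerm_sub (hN : IsPointProcess N) (h𝓕 : IsInternalHistory 𝓕 N)
    (n : ℕ) (hF : IsRegularCondDistrib P (isStoppingTime_arrivalTime hN h𝓕 n).measurableSpace
      (waitingTime N n) {ω | arrivalTime N n ω < ∞} (F n)) {s t : ℝ≥0} (hst : s ≤ t) {C : Set Ω}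
    (hC : MeasurableSet[𝓕 s] C) :
    ∫⁻ ω in C, (compensatorTerm N F n t ω - compensatorTerm N F n s ω) ∂P
      = ∫⁻ ω in C, {ω | N s ω ≤ n ∧ n < N t ω}.indicator 1 ω ∂P := by
  have hp := hF.isProbabilityMeasure
  rw [← setLIntegral_hazardRate_waitingTime hN h𝓕 n hF hC]
  refine lintegral_congr_ae (ae_restrict_of_ae ?_)
  filter_upwards [ae_compensatorTerm_lt_top hN h𝓕 n hF s] with ω hω
  simp only [compensatorTerm_eq] at hω ⊢
  refine integratedHazard_sub_integratedHazard (F n ω) (tsub_le_tsub_right ?_ _) hω.ne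
  exact_mod_cast hst

lemma ae_compensator_lt_top (hN : IsPointProcess N) (h𝓕 : IsInternalHistory 𝓕 N)
    (hF : ∀ n, IsRegularCondDistrib P (isStoppingTime_arrivalTime hN h𝓕 n).measurableSpace
      (waitingTime N n) {ω | arrivalTime N n ω < ∞} (F n)) :
    ∀ᵐ ω ∂P, ∀ t, compensator N F t ω < ∞ := by
  -- Integer times suffice by monotonicity, leaving countably many null sets.
  have h : ∀ᵐ ω ∂P, ∀ n k : ℕ, compensatorTerm N F n k ω < ∞ :=
    ae_all_iff.2 fun n => ae_all_iff.2 fun k => ae_compensatorTerm_lt_top hN h𝓕 n (hF n) k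
  filter_upwards [h] with ω hω t
  refine (compensator_mono F ω (Nat.le_ceil t)).trans_lt ?_
  change compensator N F _ ω < ∞
  rw [compensator_eq_sum F hN le_rfl]
  exact ENNReal.sum_lt_top.2 fun n _ => hω n _

variable (I : Set ℕ)

/-- Increments of the parts of `N` and of the compensator that belong to a set of indices. -/
lemma setLIntegral_tsum_sub (hN : IsPointProcess N) (h𝓕 : IsInternalHistory 𝓕 N)
    (hF : ∀ n, IsRegularCondDistrib P (isStoppingTime_arrivalTime hN h𝓕 n).measurableSpace
      (waitingTime N n) {ω | arrivalTime N n ω < ∞} (F n)) {s t : ℝ≥0} (hst : s ≤ t) {C : Set Ω}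
    (hC : MeasurableSet[𝓕 s] C) :
    ∫⁻ ω in C, (∑' n, I.indicator (fun n => (Iio (N t ω)).indicator 1 n) n
        - ∑' n, I.indicator (fun n => (Iio (N s ω)).indicator 1 n) n) ∂P
      = ∫⁻ ω in C, (∑' n, I.indicator (fun n => compensatorTerm N F n t ω) n
        - ∑' n, I.indicator (fun n => compensatorTerm N F n s ω) n) ∂P := by
  -- `N` is written as the series of the indicators of `n < N`, to be compared with the compensator
  -- term by term.
  have hleft : ∀ ω, ∑' n, I.indicator (fun n => (Iio (N t ω)).indicator (1 : ℕ → ℝ≥0∞) n) n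
      - ∑' n, I.indicator (fun n => (Iio (N s ω)).indicator 1 n) n
      = ∑' n, I.indicator (fun n => {ω | N s ω ≤ n ∧ n < N t ω}.indicator 1 ω) n := fun ω => by
    rw [← ENNReal.tsum_sub]
    · refine tsum_congr fun n => ?_
      have := hN.mono ω hst
      by_cases h1 : n ∈ I <;> by_cases h2 : n < N t ω <;> by_cases h3 : n < N s ω <;>
        simp [indicator, h1, h2, h3, not_le.2, not_lt.1]
    · rw [tsum_eq_sum (s := Finset.range (N s ω))]
      · refine (ENNReal.sum_lt_top.2 fun n _ => ?_).ne
        refine lt_of_le_of_lt ?_ ENNReal.one_lt_top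
        simp only [indicator, Pi.one_apply]
        split_ifs <;> simp
      · intro n hn
        rw [Finset.mem_range] at hn
        simp [indicator, hn]
    · intro n
      refine indicator_le_indicator (indicator_le_indicator_of_subset ?_ (fun _ => zero_le) n)
      exact Iio_subset_Iio (hN.mono ω hst)
  -- Subtracting the series termwise requires the sum at `s` to be finite, hence only almost surely.
  have hright : ∀ᵐ ω ∂P, ∑' n, I.indicator (fun n => compensatorTerm N F n t ω) n
      - ∑' n, I.indicator (fun n => compensatorTerm N F n s ω) n
      = ∑' n, I.indicator (fun n => compensatorTerm N F n t ω - compensatorTerm N F n s ω) n := by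
    filter_upwards [ae_compensator_lt_top hN h𝓕 hF] with ω hω
    rw [← ENNReal.tsum_sub]
    · refine tsum_congr fun n => ?_
      by_cases h1 : n ∈ I <;> simp [h1]
    · refine ne_top_of_le_ne_top (hω s).ne (ENNReal.tsum_le_tsum fun n => ?_)
      exact indicator_le_self' (fun _ _ => zero_le) n
    · exact fun n => indicator_le_indicator (compensatorTerm_mono F n ω hst)
  have hmeas : ∀ n u, Measurable (compensatorTerm N F n u) := fun n u =>
    (measurable_compensatorTerm hN h𝓕 n (hF n) u).mono (𝓕.le u) le_rfl
  have hNm : ∀ u, Measurable (N u) := fun u => (h𝓕.measurable u).mono (𝓕.le u) le_rfl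
  have hset : ∀ n, MeasurableSet {ω | N s ω ≤ n ∧ n < N t ω} := fun n =>
    (hNm s (MeasurableSet.of_discrete (s := Iic n))).inter
      (hNm t (MeasurableSet.of_discrete (s := Ioi n)))
  simp_rw [hleft]
  rw [lintegral_congr_ae (ae_restrict_of_ae hright), lintegral_tsum, lintegral_tsum]
  · refine tsum_congr fun n => ?_
    by_cases h1 : n ∈ I
    · simp only [h1, indicator_of_mem]
      exact (setLIntegral_compensatorTerm_sub hN h𝓕 n (hF n) hst hC).symm
    · simp [h1]
  · intro n
    by_cases h1 : n ∈ I
    · simp only [h1, indicator_of_mem]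
      exact ((hmeas n t).sub (hmeas n s)).aemeasurable
    · simp [h1]
  · intro n
    by_cases h1 : n ∈ I
    · simp only [h1, indicator_of_mem]
      exact (measurable_one.indicator (hset n)).aemeasurable
    · simp [h1]

lemma tsum_indicator_Iio_indicator (k j : ℕ) :
    ∑' n, (Iio k).indicator (fun n => (Iio j).indicator (1 : ℕ → ℝ≥0∞) n) n
      = (min j k : ℕ) := by
  rw [tsum_eq_sum (s := Finset.range (min j k))]
  · rw [Finset.sum_congr rfl (g := fun _ => 1)]
    · simp
    · intro n hn
      rw [Finset.mem_range, lt_min_iff] at hn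
      simp [hn]
  · intro n hn
    rw [Finset.mem_range, lt_min_iff] at hn
    simp only [indicator, mem_Iio]
    grind

lemma tsum_indicator_univ_indicator (j : ℕ) :
    ∑' n, (univ : Set ℕ).indicator (fun n => (Iio j).indicator (1 : ℕ → ℝ≥0∞) n) n = j := by
  have h := tsum_indicator_Iio_indicator j j
  rw [min_self] at h
  rw [← h]
  refine tsum_congr fun n => ?_
  by_cases hn : n < j <;> simp [hn]

end Increments

/-! ### Stopping at an arrival time. -/

section Stopping

variable {Ω : Type*} {N : ℝ≥0 → Ω → ℕ}

/-- Compare which `j` lie below each side: `T j ≤ T k` forces `j ≤ k` when `T j ≤ t`, since finite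
arrival times increase strictly. -/
lemma stopped_eq_min (hN : IsPointProcess N) (k : ℕ) (t v : ℝ≥0) (ω : Ω)
    (hv : (v : ℝ≥0∞) = min (t : ℝ≥0∞) (arrivalTime N k ω)) : N v ω = min (N t ω) k := by
  refine eq_of_forall_le_iff fun j => ?_
  rw [← arrivalTime_le_iff hN, hv, le_min_iff, le_min_iff, arrivalTime_le_iff hN]
  refine and_congr_right fun hj => ⟨fun h => ?_, fun h => arrivalTime_mono ω h⟩
  by_contra! hkj
  have h1 : arrivalTime N k ω < ∞ :=
    ((arrivalTime_mono ω hkj.le).trans ((arrivalTime_le_iff hN j ω t).2 hj)).trans_lt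
      ENNReal.coe_lt_top
  exact (arrivalTime_lt_succ hN h1).not_ge ((arrivalTime_mono ω hkj).trans h)

/-- For `n < k` stopping at `T k` changes nothing, the term being already cut off at `U (n + 1) ≤ T
k - T n`; for `n ≥ k` the term has not started. -/
lemma compensator_stopped_eq (F : ℕ → Ω → Measure ℝ≥0∞) (k : ℕ) (t v : ℝ≥0) (ω : Ω)
    (hv : (v : ℝ≥0∞) = min (t : ℝ≥0∞) (arrivalTime N k ω)) :
    compensator N F v ω = ∑' n, (Iio k).indicator (fun n => compensatorTerm N F n t ω) n := by
  refine tsum_congr fun n => ?_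
  rcases lt_or_ge n k with h | h
  · rw [indicator_of_mem (mem_Iio.2 h), compensatorTerm_eq, compensatorTerm_eq, hv,
      Monotone.map_min (f := fun x : ℝ≥0∞ => x - arrivalTime N n ω)
        fun _ _ h => tsub_le_tsub_right h _, min_assoc, min_eq_right (b := waitingTime N n ω)]
    exact tsub_le_tsub_right (arrivalTime_mono ω h) _
  · rw [indicator_of_notMem (by simpa using h)]
    refine compensatorTerm_eq_zero F ?_
    rw [hv]
    exact (min_le_right _ _).trans (arrivalTime_mono ω h)

/-- Identifies the time at which `stoppedProcess` is evaluated; the minimum is finite, so the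
default value of `untopA` never occurs. -/
lemma coe_untopA_min (t : ℝ≥0) (x : ℝ≥0∞) :
    (((min (t : WithTop ℝ≥0) x).untopA : ℝ≥0) : ℝ≥0∞) = min (t : ℝ≥0∞) x := by
  have h : min (t : WithTop ℝ≥0) x ≠ ⊤ :=
    ne_top_of_le_ne_top (b := (t : WithTop ℝ≥0)) WithTop.coe_ne_top (min_le_left _ _)
  rw [WithTop.untopA_eq_untop h]
  exact WithTop.coe_untop _ h

end Stopping

end PointProcess

end

/-! ### Assembly of the theorem. -/

theorem theorem3p1 {Ω : Type*} {m : MeasurableSpace Ω} (P : Measure Ω) [IsProbabilityMeasure P]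
    (𝓕 : Filtration ℝ≥0 m) (N : ℝ≥0 → Ω → ℕ)
    (hN : PointProcess.IsPointProcess N) (h𝓕 : PointProcess.IsInternalHistory 𝓕 N)
    (F : ℕ → Ω → Measure ℝ≥0∞)
    (hF : ∀ n, PointProcess.IsRegularCondDistrib P
      (PointProcess.isStoppingTime_arrivalTime hN h𝓕 n).measurableSpace
      (PointProcess.waitingTime N n) {ω | PointProcess.arrivalTime N n ω < ∞} (F n)) :
    PointProcess.IsMeanIntensity 𝓕 P N (PointProcess.compensator N F) := by
  have hpred : IsStronglyPredictable 𝓕 (PointProcess.compensator N F) :=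
    PointProcess.measurable_predictable_compensator hN h𝓕 hF |>.stronglyMeasurable
  have hincr : ∀ s t, s ≤ t → ∀ C, MeasurableSet[𝓕 s] C →
      ∫⁻ ω in C, ((N t ω : ℝ≥0∞) - N s ω) ∂P
        = ∫⁻ ω in C, (PointProcess.compensator N F t ω - PointProcess.compensator N F s ω) ∂P :=
    fun s t hst C hC => by
      have h := PointProcess.setLIntegral_tsum_sub univ hN h𝓕 hF hst hC
      simp only [PointProcess.tsum_indicator_univ_indicator] at h
      simpa only [indicator_univ, PointProcess.compensator] using h
  refine ⟨⟨hpred, PointProcess.compensator_zero F, PointProcess.compensator_mono F,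
    fun ω => PointProcess.continuousWithinAt_compensator F hN ω
      fun n => (hF n).isProbabilityMeasure ω, PointProcess.ae_compensator_lt_top hN h𝓕 hF⟩,
    hincr, ?_, fun k => ?_, fun h => ?_⟩
  · exact
      { isStoppingTime := PointProcess.isStoppingTime_arrivalTime hN h𝓕
        tendsto_top := ae_of_all _ fun ω => PointProcess.tendsto_arrivalTime hN ω
        mono := ae_of_all _ fun ω => PointProcess.arrivalTime_mono ω }
  · have heq : stoppedProcess (PointProcess.compensated N (PointProcess.compensator N F))
        (PointProcess.arrivalTime N k) = PointProcess.compensated (fun t ω => min (N t ω) k)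
        fun t ω => ∑' n, (Iio k).indicator (fun n => PointProcess.compensatorTerm N F n t ω) n := by
      ext t ω
      have hv := PointProcess.coe_untopA_min t (PointProcess.arrivalTime N k ω)
      simp only [stoppedProcess, PointProcess.compensated]
      rw [PointProcess.stopped_eq_min hN k t _ ω hv,
        PointProcess.compensator_stopped_eq F k t _ ω hv]
    rw [heq]
    have hsum : ∀ t ω, ∑' n, (Iio k).indicator
        (fun n => PointProcess.compensatorTerm N F n t ω) n
        = ∑ n ∈ Finset.range k, PointProcess.compensatorTerm N F n t ω := fun t ω => by
      rw [tsum_eq_sum (s := Finset.range k) fun n hn => indicator_of_notMem (by simpa using hn) _]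
      exact Finset.sum_congr rfl fun n hn => by simp_all
    have hterm := fun n t => PointProcess.measurable_compensatorTerm hN h𝓕 n (hF n) t
    refine PointProcess.martingale_compensated (fun t => (h𝓕.measurable t).min measurable_const)
      (fun t => ?_) (fun ω s t hst => min_le_min_right _ (hN.mono ω hst))
      (fun ω s t hst => ENNReal.tsum_le_tsum fun n =>
        indicator_le_indicator (PointProcess.compensatorTerm_mono F n ω hst))
      (fun s t hst C hC => ?_) (fun t => ?_) fun t => ?_
    · simp_rw [hsum]
      exact Finset.measurable_sum _ fun n _ => hterm n t
    · simpa only [PointProcess.tsum_indicator_Iio_indicator] using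
        PointProcess.setLIntegral_tsum_sub (Iio k) hN h𝓕 hF hst hC
    -- The stopped counting process is bounded by `k`; its compensator is a sum of `k` terms of mean
    -- at most `1`.
    · refine ne_top_of_le_ne_top (b := ∫⁻ _, (k : ℝ≥0∞) ∂P) (by simp) (lintegral_mono fun ω => ?_)
      exact Nat.cast_le.2 (min_le_right _ _)
    · simp_rw [hsum]
      rw [lintegral_finsetSum _ fun n _ => (hterm n t).mono (𝓕.le t) le_rfl]
      exact (ENNReal.sum_lt_top.2 fun n _ =>
        (PointProcess.lintegral_compensatorTerm_le_one hN h𝓕 n (hF n) t).trans_lt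
          ENNReal.one_lt_top).ne
  -- Increments from time `0` show that `N t` and `A t` have the same mean, so either integrability
  -- hypothesis gives the other.
  · have hmean : ∀ t, ∫⁻ ω, (N t ω : ℝ≥0∞) ∂P = ∫⁻ ω, PointProcess.compensator N F t ω ∂P :=
      fun t => by
        simpa [hN.zero, PointProcess.compensator_zero] using
          hincr 0 t (zero_le) univ MeasurableSet.univ
    have hfin : ∀ t, ∫⁻ ω, (N t ω : ℝ≥0∞) ∂P ≠ ∞ := fun t => by
      rcases h with h | h
      · exact (h t).ne
      · exact hmean t ▸ (h t).ne
    exact PointProcess.martingale_compensated h𝓕.measurable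
      (fun t => (hpred.stronglyAdapted t).measurable) hN.mono (PointProcess.compensator_mono F)
      hincr hfin fun t => hmean t ▸ hfin t
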